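/- Let $\mu$ be a probability measure on $\mathbb R$ with cumulative distribution function $F(x)=\mu((-\infty,x])$ and quantile function $F^{-1}(u)=\inf\{x\in\mathbb R: F(x)\ge u\}$, $u\in(0,1)$. For $\rho\ge 1$ and $N\ge 1$ let $$e_N(\mu,\rho)=\inf\Big\{\mathcal W_\rho\Big(\frac1N\sum_{i=1}^N\delta_{x_i},\mu\Big): -\infty<x_1\le x_2\le\cdots\le x_N<+\infty\Big\}\in[0,+\infty],$$ where $\mathcal W_\rho(\nu,\eta)=\big(\inf_\pi\int_{\mathbb R\times\mathbb R}|x-y|^\rho\,\pi(dx,dy)\big)^{1/\rho}$, the infimum being over all couplings $\pi$ of $\nu$ and $\eta$, is the Wasserstein distance with index $\rho$. Let $\rho\ge1$ and $\alpha\in(0,\frac1\rho)$. Then $$\sup_{x\ge 0}\,x^{\frac{\rho}{1-\alpha\rho}}\big(F(-x)+1-F(x)\big)<+\infty\iff \sup_{N\ge 1}N^\alpha e_N(\mu,\rho)<+\infty.$$ More precisely, setting $C=\sup_{x\ge 0}x^{\frac{\rho}{1-\alpha\rho}}\big(F(-x)+1-F(x)\big)\in[0,+\infty]$, we have $$\sup_{N\ge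 1}N^{\alpha\rho}e_N^\rho(\mu,\rho)\le 2^\rho C^{1-\alpha\rho}+\frac{1-\alpha\rho}{\alpha\rho}C+1+2^{\rho-1}+2^{\rho+\alpha\rho-2}\left|F^{-1}(1/2)\right|^\rho.$$ Last, if $\limsup_{x\to+\infty}x^{\frac{\rho}{1-\alpha\rho}}\big(F(-x)+1-F(x)\big)\in(0,+\infty)$, then $\limsup_{N\to+\infty}N^\alpha e_N(\mu,\rho)\in(0,+\infty)$. -/

import Mathlib

open MeasureTheory ProbabilityTheory Filter
open scoped ENNReal

/-- `IsCoupling π ν η`: the measure `π` on `ℝ × ℝ` has marginals `ν` and `η`. -/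
def IsCoupling (π : Measure (ℝ × ℝ)) (ν η : Measure ℝ) : Prop :=
  π.map Prod.fst = ν ∧ π.map Prod.snd = η

/-- The Wasserstein distance with index `ρ` between two measures on the real line,
`(inf_π ∫ |x - y| ^ ρ dπ(x, y)) ^ (1 / ρ)` over all couplings `π`, with values in `[0, ∞]`. -/
noncomputable def wasserstein (ρ : ℝ) (ν η : Measure ℝ) : ℝ≥0∞ :=
  (⨅ (π : Measure (ℝ × ℝ)) (_ : IsCoupling π ν η),
    ∫⁻ p, ENNReal.ofReal (|p.1 - p.2| ^ ρ) ∂π) ^ (1 / ρ)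

/-- The uniformly weighted measure `(1 / N) ∑ i, δ_{x i}`. -/
noncomputable def uniformAtoms {N : ℕ} (x : Fin N → ℝ) : Measure ℝ :=
  (N : ℝ≥0∞)⁻¹ • ∑ i, Measure.dirac (x i)

/-- `e_N(μ, ρ)`: the infimum of the `ρ`-Wasserstein distance between `μ` and
`(1 / N) ∑ i, δ_{x i}` over `x 1 ≤ ⋯ ≤ x N` in `ℝ`. -/
noncomputable def quantError (N : ℕ) (μ : Measure ℝ) (ρ : ℝ) : ℝ≥0∞ :=
  ⨅ (x : Fin N → ℝ) (_ : Monotone x), wasserstein ρ (uniformAtoms x) μ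

/-- The quantile function `F⁻¹(u) = inf {x | u ≤ F(x)}`, where `F` is the cumulative
distribution function of `μ`. -/
noncomputable def quantile (μ : Measure ℝ) (u : ℝ) : ℝ :=
  sInf {x : ℝ | u ≤ cdf μ x}

/-- The weighted tail `x ^ β * (F(-x) + 1 - F(x))`, used for `x ≥ 0`, seen in `[0, ∞]`. -/
noncomputable def weightedTail (μ : Measure ℝ) (β x : ℝ) : ℝ≥0∞ :=
  ENNReal.ofReal (x ^ β * (cdf μ (-x) + 1 - cdf μ x))

/-- `sup_{x ≥ 0} x ^ β * (F(-x) + 1 - F(x))`, with values in `[0, ∞]`. -/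
noncomputable def tailSup (μ : Measure ℝ) (β : ℝ) : ℝ≥0∞ :=
  ⨆ (x : ℝ) (_ : 0 ≤ x), weightedTail μ β x

/-- `sup_{N ≥ 1} a N` for a sequence with values in `[0, ∞]`. -/
noncomputable def supGeOne (a : ℕ → ℝ≥0∞) : ℝ≥0∞ :=
  ⨆ (N : ℕ) (_ : 1 ≤ N), a N

/-! Write `β = ρ / (1 - α * ρ)`, so that `1 / β = 1 / ρ - α`.

From error to tail: if `μ` has mass at least `1/(4N)` beyond radius `b` but at most `3/(4N)` beyond
`a ≤ b`, then mass `1/(4N)` must travel at least `(b - a)/2` (`le_transportCost_uniformAtoms`). An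
error of at most `K * N ^ (-α)` therefore makes the tail drop from `3/(4N)` to `1/(4N)` over a
distance of order `K * N ^ (1/ρ - α)`. Iterating along `N = 3 ^ k` gives geometrically growing
radii, hence a tail of order `K ^ β * x ^ (-β)` (`exists_eventually_weightedTail_le`). The prefactor
does not depend on `K`, so letting `K → 0` also gives the positivity of the last limsup.

From tail to error: couple the `i`-th atom with the `i`-th block of length `1/N` of the quantile
function (`quantError_rpow_le`). Interior atoms sit at quantiles, and their cost is at most `(F⁻¹(1
- 1/N) - F⁻¹(1/N)) ^ ρ / N`. The extreme atoms are pushed out to `±M` at least, where `M ^ ρ = N ^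
(1 - α * ρ)`, so that the outer blocks cost little more than the part of the `ρ`-th moment above `M
^ ρ`, which the layer-cake formula controls. Keeping track of constants gives
`quantError_rpow_le_of_tail_le`. -/

/-! ### Lower bounds for the quantization error -/

lemma uniformAtoms_apply_eq_zero {N : ℕ} {x : Fin N → ℝ} {s : Set ℝ} (hs : MeasurableSet s)
    (h : ∀ i, x i ∉ s) : uniformAtoms x s = 0 := by
  simp [uniformAtoms, Measure.dirac_apply' _ hs, h]

lemma inv_le_uniformAtoms_apply {N : ℕ} {x : Fin N → ℝ} {s : Set ℝ} (hs : MeasurableSet s)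
    {i : Fin N} (h : x i ∈ s) : (N : ℝ≥0∞)⁻¹ ≤ uniformAtoms x s := by
  have : (1 : ℝ≥0∞) ≤ ∑ j, Measure.dirac (x j) s := by
    calc (1 : ℝ≥0∞) = Measure.dirac (x i) s := by simp [Measure.dirac_apply' _ hs, h]
      _ ≤ _ := Finset.single_le_sum (f := fun j => Measure.dirac (x j) s)
        (fun _ _ => zero_le) (Finset.mem_univ i)
  simpa [uniformAtoms] using mul_le_mul_right this (N : ℝ≥0∞)⁻¹

/-- Radial lower bound for the transport cost from `N` equally weighted atoms: the mass of `μ`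
beyond radius `a` is too far from `0` and from `1 / N` to be matched cheaply. -/
lemma le_transportCost_uniformAtoms {N : ℕ} (hN : 1 ≤ N) {x : Fin N → ℝ} {μ : Measure ℝ}
    {π : Measure (ℝ × ℝ)} (hπ : IsCoupling π (uniformAtoms x) μ) {ρ a b : ℝ} (hρ : 0 ≤ ρ)
    (hab : a ≤ b) (hb : ENNReal.ofReal (1 / (4 * N)) ≤ μ {y | b ≤ |y|})
    (ha : μ {y | a < |y|} ≤ ENNReal.ofReal (3 / (4 * N))) :
    ENNReal.ofReal (((b - a) / 2) ^ ρ / (4 * N)) ≤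
      ∫⁻ p, ENNReal.ofReal (|p.1 - p.2| ^ ρ) ∂π := by
  obtain ⟨h1, h2⟩ := hπ
  have hN0 : (0 : ℝ) < N := by exact_mod_cast hN
  set S : Set (ℝ × ℝ) :=
    {p | ENNReal.ofReal (((b - a) / 2) ^ ρ) ≤ ENNReal.ofReal (|p.1 - p.2| ^ ρ)} with hS
  have hmS : ∀ p : ℝ × ℝ, (b - a) / 2 ≤ |p.1 - p.2| → p ∈ S := fun p hp =>
    ENNReal.ofReal_le_ofReal (Real.rpow_le_rpow (by linarith) hp hρ)
  have mb : MeasurableSet {y : ℝ | b ≤ |y|} := measurableSet_le measurable_const (by fun_prop)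
  have ma : MeasurableSet {y : ℝ | a < |y|} := measurableSet_lt measurable_const (by fun_prop)
  have mc : MeasurableSet {y : ℝ | (a + b) / 2 < |y|} :=
    measurableSet_lt measurable_const (by fun_prop)
  have key : ENNReal.ofReal (1 / (4 * N)) ≤ π S := by
    -- With no atom beyond the midpoint, all the mass of `μ` beyond `b` travels at least `(b -
    -- a)/2`.
    by_cases hx : ∀ i, x i ∉ {y : ℝ | (a + b) / 2 < |y|}
    · have h0 := uniformAtoms_apply_eq_zero mc hx
      rw [← h1, Measure.map_apply measurable_fst mc] at h0
      rw [← h2, Measure.map_apply measurable_snd mb] at hb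
      refine hb.trans ?_
      calc _ ≤ π (S ∪ Prod.fst ⁻¹' {y : ℝ | (a + b) / 2 < |y|}) := by
            refine measure_mono fun p hp => ?_
            by_cases hc : (a + b) / 2 < |p.1|
            · exact Or.inr hc
            · left
              apply hmS
              have : |p.2| - |p.1| ≤ |p.1 - p.2| := by
                rw [abs_sub_comm]; exact abs_sub_abs_le_abs_sub _ _
              have hp' : b ≤ |p.2| := hp
              linarith
        _ ≤ _ := (measure_union_le _ _).trans (by rw [h0, add_zero])
    · push Not at hx
      obtain ⟨i, hi⟩ := hx
      have h0 := inv_le_uniformAtoms_apply mc hi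
      rw [← h1, Measure.map_apply measurable_fst mc] at h0
      rw [← h2, Measure.map_apply measurable_snd ma] at ha
      -- An atom beyond the midpoint has mass `1/N`, of which at most `3/(4N)` can be sent beyond
      -- `a`; the remaining `1/(4N)` travels far.
      have h3 : (N : ℝ≥0∞)⁻¹ =
          ENNReal.ofReal (1 / (4 * N)) + ENNReal.ofReal (3 / (4 * N)) := by
        rw [← ENNReal.ofReal_add (by positivity) (by positivity),
          ← ENNReal.ofReal_natCast, ← ENNReal.ofReal_inv_of_pos hN0]
        congr 1
        field_simp
        norm_num
      refine ENNReal.le_of_add_le_add_right (a := ENNReal.ofReal (3 / (4 * N)))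
        ENNReal.ofReal_ne_top ?_
      rw [← h3]
      refine h0.trans ?_
      calc _ ≤ π (S ∪ Prod.snd ⁻¹' {y : ℝ | a < |y|}) := by
            refine measure_mono fun p hp => ?_
            by_cases hc : a < |p.2|
            · exact Or.inr hc
            · left
              apply hmS
              have : |p.1| - |p.2| ≤ |p.1 - p.2| := abs_sub_abs_le_abs_sub _ _
              have hp' : (a + b) / 2 < |p.1| := hp
              linarith
        _ ≤ _ := (measure_union_le _ _).trans (by gcongr)
  have hmeas : Measurable fun p : ℝ × ℝ => ENNReal.ofReal (|p.1 - p.2| ^ ρ) := by fun_prop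
  calc _ = ENNReal.ofReal (((b - a) / 2) ^ ρ) * ENNReal.ofReal (1 / (4 * N)) := by
        rw [← ENNReal.ofReal_mul (by have : 0 ≤ (b - a) / 2 := by linarith
                                     positivity)]
        congr 1; ring
    _ ≤ _ := by gcongr
    _ ≤ _ := mul_meas_ge_le_lintegral hmeas _

lemma le_quantError {N : ℕ} (hN : 1 ≤ N) {μ : Measure ℝ} {ρ a b : ℝ} (hρ : 0 < ρ)
    (hab : a ≤ b) (hb : ENNReal.ofReal (1 / (4 * N)) ≤ μ {y | b ≤ |y|})
    (ha : μ {y | a < |y|} ≤ ENNReal.ofReal (3 / (4 * N))) :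
    ENNReal.ofReal ((b - a) / 2 / (4 * N) ^ (1 / ρ)) ≤ quantError N μ ρ := by
  refine le_iInf₂ fun x _ => ?_
  have hba : 0 ≤ (b - a) / 2 := by linarith
  have h : ENNReal.ofReal ((b - a) / 2 / (4 * N) ^ (1 / ρ)) =
      ENNReal.ofReal (((b - a) / 2) ^ ρ / (4 * N)) ^ (1 / ρ) := by
    rw [ENNReal.ofReal_rpow_of_nonneg (by positivity) (by positivity),
      Real.div_rpow (by positivity) (by positivity), ← Real.rpow_mul hba,
      mul_one_div_cancel hρ.ne', Real.rpow_one]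
  rw [h, wasserstein]
  refine ENNReal.rpow_le_rpow (le_iInf₂ fun π hπ => ?_) (by positivity)
  exact le_transportCost_uniformAtoms hN hπ hρ.le hab hb ha

/-- Contrapositive of `le_quantError`, and the induction step for the tail: a good `N`-point
approximation divides the tail bound by 3 over a controlled distance. -/
lemma measureReal_radial_lt {N : ℕ} (hN : 1 ≤ N) {μ : Measure ℝ} [IsProbabilityMeasure μ]
    {ρ α K a b : ℝ} (hρ : 0 < ρ) (hK : 0 ≤ K)
    (h : (N : ℝ≥0∞) ^ α * quantError N μ ρ ≤ ENNReal.ofReal K)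
    (hab : 2 * 4 ^ (1 / ρ) * K * (N : ℝ) ^ (1 / ρ - α) < b - a)
    (ha : μ.real {y | a < |y|} ≤ 3 / (4 * N)) : μ.real {y | b ≤ |y|} < 1 / (4 * N) := by
  have hN0 : (0 : ℝ) < N := by exact_mod_cast hN
  by_contra! hb
  have h0 : 0 < b - a := lt_of_le_of_lt (by positivity) hab
  have h1 := le_quantError hN hρ (by linarith : a ≤ b)
    ((ENNReal.ofReal_le_iff_le_toReal (measure_ne_top _ _)).2 hb)
    ((ENNReal.le_ofReal_iff_toReal_le (measure_ne_top _ _) (by positivity)).2 ha)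
  have h2 := (mul_le_mul_right h1 ((N : ℝ≥0∞) ^ α)).trans h
  rw [← ENNReal.ofReal_natCast, ENNReal.ofReal_rpow_of_pos hN0,
    ← ENNReal.ofReal_mul (by positivity), ENNReal.ofReal_le_ofReal_iff hK,
    Real.mul_rpow (by positivity) (by positivity)] at h2
  rw [Real.rpow_sub hN0] at hab
  have e1 : (0:ℝ) < 4 ^ (1 / ρ) := by positivity
  have e2 : (0:ℝ) < (N : ℝ) ^ (1 / ρ) := by positivity
  have e3 : (0:ℝ) < (N : ℝ) ^ α := by positivity
  rw [← mul_div_assoc, div_lt_iff₀ e3] at hab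
  rw [← mul_div_assoc, div_le_iff₀ (by positivity)] at h2
  nlinarith

/-! ### Tails through the distribution function and through the radius -/

lemma cdf_tail_le_radial (μ : Measure ℝ) [IsProbabilityMeasure μ] {x : ℝ} (hx : 0 < x) :
    cdf μ (-x) + 1 - cdf μ x ≤ μ.real {y | x ≤ |y|} := by
  have h : 1 - cdf μ x = μ.real (Set.Ioi x) := by
    rw [cdf_eq_real, ← Set.compl_Iic, probReal_compl_eq_one_sub measurableSet_Iic]
  rw [add_sub_assoc, h, cdf_eq_real, ← measureReal_union _ measurableSet_Ioi]
  · refine measureReal_mono ?_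
    rintro y (hy | hy)
    · exact (by linarith [Set.mem_Iic.1 hy] : x ≤ -y).trans (neg_le_abs y)
    · exact (Set.mem_Ioi.1 hy).le.trans (le_abs_self y)
  · rw [Set.disjoint_left]
    intro y hy hy'
    have := Set.mem_Iic.1 hy
    have := Set.mem_Ioi.1 hy'
    linarith

lemma radial_le_cdf_tail (μ : Measure ℝ) [IsProbabilityMeasure μ] (x : ℝ) :
    μ.real {y | x < |y|} ≤ cdf μ (-x) + 1 - cdf μ x := by
  have h : 1 - cdf μ x = μ.real (Set.Ioi x) := by
    rw [cdf_eq_real, ← Set.compl_Iic, probReal_compl_eq_one_sub measurableSet_Iic]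
  rw [add_sub_assoc, h, cdf_eq_real]
  refine le_trans (measureReal_mono ?_) (measureReal_union_le _ _)
  intro y (hy : x < |y|)
  rcases lt_abs.1 hy with hy | hy
  · exact Or.inr hy
  · exact Or.inl (by simp only [Set.mem_Iic]; linarith)

lemma tendsto_measureReal_radial (μ : Measure ℝ) [IsProbabilityMeasure μ] :
    Tendsto (fun x => μ.real {y | x ≤ |y|}) atTop (nhds 0) := by
  have h1 := tendsto_cdf_atTop μ
  have h2 := (tendsto_cdf_atBot μ).comp tendsto_neg_atTop_atBot
  have h3 := (h2.add (tendsto_const_nhds (x := (1 : ℝ)))).sub h1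
  simp only [zero_add, sub_self] at h3
  have h4 := h3.comp (tendsto_atTop_add_const_right atTop (-1 : ℝ) tendsto_id)
  refine squeeze_zero (fun _ => measureReal_nonneg) (fun x => ?_) h4
  -- The shift by 1 passes from the closed condition `x ≤ |y|` to an open one.
  refine le_trans (measureReal_mono ?_) (radial_le_cdf_tail μ (x - 1))
  intro y (hy : x ≤ |y|)
  change x - 1 < |y|
  linarith

/-! ### From decay of the error to decay of the tail -/

lemma div_one_sub_mul_eq {ρ α : ℝ} (hρ : 0 < ρ) : ρ / (1 - α * ρ) = (1 / ρ - α)⁻¹ := by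
  have : 1 / ρ - α = (1 - α * ρ) / ρ := by field_simp
  rw [this, inv_div]

/-- A decay `K * N ^ (-α)` of the quantization error forces the tail decay
`c * K ^ β * x ^ (-β)` with `β = ρ / (1 - α * ρ)`. -/
lemma exists_eventually_weightedTail_le (μ : Measure ℝ) [IsProbabilityMeasure μ] {ρ α : ℝ}
    (hρ : 0 < ρ) (hα1 : α < 1 / ρ) :
    ∃ c : ℝ, 0 < c ∧ ∀ K : ℝ, 0 < K →
      (∀ᶠ N : ℕ in atTop, (N : ℝ≥0∞) ^ α * quantError N μ ρ ≤ ENNReal.ofReal K) →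
      ∀ᶠ x : ℝ in atTop, weightedTail μ (ρ / (1 - α * ρ)) x ≤
        ENNReal.ofReal (c * K ^ (ρ / (1 - α * ρ))) := by
  rw [div_one_sub_mul_eq hρ]
  set g := 1 / ρ - α with hg
  have hg0 : 0 < g := by linarith
  set q : ℝ := 3 ^ g with hq
  have hq1 : 1 < q := Real.one_lt_rpow (by norm_num) hg0
  have hq0 : 0 < q := by linarith
  -- Chosen so that consecutive radii `B + D * q ^ k` differ by `4 * 4 ^ (1 / ρ) * K * q ^ (k + 1)`,
  -- twice the threshold in `measureReal_radial_lt`, where the inequality is strict.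
  set d : ℝ := 4 * 4 ^ (1 / ρ) / (1 - q⁻¹) with hd
  have hqi : 0 < 1 - q⁻¹ := by have := inv_lt_one_of_one_lt₀ hq1; linarith
  have hd0 : 0 < d := by positivity
  have hqk : ∀ k : ℕ, ((3 : ℝ) ^ k) ^ g = q ^ k := fun k => by
    rw [hq, ← Real.rpow_natCast, ← Real.rpow_mul (by norm_num), mul_comm, Real.rpow_mul (by norm_num),
      Real.rpow_natCast]
  -- The factor `3 / 4` is `3 ^ (k + 1) / (4 * 3 ^ k)`; the factor `2` absorbs the offset `B`
  -- through `x ≤ 2 * (x - B)`.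
  refine ⟨3 / 4 * (2 * d) ^ g⁻¹, by positivity, fun K hK h => ?_⟩
  obtain ⟨k₀, hk₀⟩ := eventually_atTop.1 h
  obtain ⟨B, hB⟩ := eventually_atTop.1 ((tendsto_measureReal_radial μ).eventually_le_const
    (show (0 : ℝ) < 1 / (4 * 3 ^ k₀) by positivity))
  set D := d * K with hD
  have hD0 : 0 < D := by positivity
  have main : ∀ k ≥ k₀, μ.real {y | B + D * q ^ k ≤ |y|} ≤ 1 / (4 * 3 ^ k) := by
    intro k hk
    induction k, hk using Nat.le_induction with
    | base => exact hB _ (le_add_of_nonneg_right (by positivity))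
    | succ k hk ih =>
      -- For `N = 3 ^ (k + 1)` the admissible mass `3/(4N)` is exactly the bound `1/(4 * 3 ^ k)`
      -- from the previous radius.
      have := measureReal_radial_lt (N := 3 ^ (k + 1)) (μ := μ) (α := α) (K := K)
        (a := B + D * q ^ k) (b := B + D * q ^ (k + 1)) (Nat.one_le_pow _ _ (by norm_num)) hρ hK.le
        (hk₀ _ (hk.trans ((Nat.lt_pow_self (by norm_num : 1 < 3)).le.trans
          (Nat.pow_le_pow_right (by norm_num) (Nat.le_succ k))))) ?_ ?_
      · push_cast at this
        exact this.le
      · push_cast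
        rw [hqk]
        have e : B + D * q ^ (k + 1) - (B + D * q ^ k) = 4 * 4 ^ (1 / ρ) * K * q ^ (k + 1) := by
          have : d * (1 - q⁻¹) = 4 * 4 ^ (1 / ρ) := div_mul_cancel₀ _ hqi.ne'
          rw [← this, hD]
          field_simp
          ring
        rw [e]
        gcongr
        norm_num
      · refine (measureReal_mono fun y hy => ?_).trans (ih.trans (le_of_eq ?_))
        · exact (show B + D * q ^ k < |y| from hy).le
        · push_cast; rw [pow_succ]; field_simp
  filter_upwards [eventually_ge_atTop (B + D * q ^ k₀), eventually_ge_atTop (2 * B),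
    eventually_gt_atTop 0] with x hx1 hx2 hx0
  have hx' : q ^ k₀ ≤ (x - B) / D := by
    rw [le_div_iff₀ hD0]; linarith
  obtain ⟨k, hk1, hk2⟩ := exists_nat_pow_near ((one_le_pow₀ hq1.le).trans hx') hq1
  have hk : k₀ ≤ k := Nat.lt_succ_iff.1 ((pow_lt_pow_iff_right₀ hq1).1 (hx'.trans_lt hk2))
  rw [le_div_iff₀ hD0] at hk1
  rw [div_lt_iff₀ hD0] at hk2
  refine ENNReal.ofReal_le_ofReal ?_
  have hT : cdf μ (-x) + 1 - cdf μ x ≤ 1 / (4 * 3 ^ k) := by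
    refine (cdf_tail_le_radial μ hx0).trans ((measureReal_mono fun y hy => ?_).trans (main k hk))
    have hy : x ≤ |y| := hy
    change B + D * q ^ k ≤ |y|
    linarith
  have hxb : x ^ g⁻¹ ≤ (2 * d) ^ g⁻¹ * K ^ g⁻¹ * 3 ^ (k + 1) := by
    have e : ((3 : ℝ) ^ (k + 1)) = (q ^ (k + 1)) ^ g⁻¹ := by
      rw [← hqk, ← Real.rpow_mul (by positivity), mul_inv_cancel₀ hg0.ne', Real.rpow_one]
    rw [e, ← Real.mul_rpow (by positivity) (by positivity),
      ← Real.mul_rpow (by positivity) (by positivity)]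
    refine Real.rpow_le_rpow hx0.le ?_ (by positivity)
    rw [hD] at hk2
    nlinarith
  have hT0 : 0 ≤ cdf μ (-x) + 1 - cdf μ x := measureReal_nonneg.trans (radial_le_cdf_tail μ x)
  calc _ ≤ (2 * d) ^ g⁻¹ * K ^ g⁻¹ * 3 ^ (k + 1) * (1 / (4 * 3 ^ k)) := by gcongr
    _ = _ := by rw [pow_succ]; field_simp

/-- On a bounded range of `x` the unweighted tail is at most 2, so only large `x` matters. -/
lemma tailSup_lt_top_of_eventually_le (μ : Measure ℝ) [IsProbabilityMeasure μ] {β : ℝ}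
    (hβ : 0 ≤ β) {c : ℝ≥0∞} (hc : c < ∞)
    (h : ∀ᶠ x : ℝ in atTop, weightedTail μ β x ≤ c) : tailSup μ β < ∞ := by
  obtain ⟨X, hX⟩ := eventually_atTop.1 h
  refine lt_of_le_of_lt (iSup₂_le fun x hx => ?_)
    (max_lt hc (ENNReal.ofReal_lt_top (r := X ^ β * 2)))
  rcases le_total X x with h' | h'
  · exact (hX x h').trans (le_max_left _ _)
  · refine le_max_of_le_right (ENNReal.ofReal_le_ofReal ?_)
    have h1 := cdf_le_one μ (-x)
    have h2 := cdf_nonneg μ x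
    have h3 : x ^ β ≤ X ^ β := Real.rpow_le_rpow hx h' hβ
    have h4 : 0 ≤ x ^ β := by positivity
    calc _ ≤ x ^ β * 2 := by gcongr; linarith
      _ ≤ _ := by gcongr

lemma exists_eventually_le_of_supGeOne_lt_top {a : ℕ → ℝ≥0∞} (h : supGeOne a < ∞) :
    ∃ K : ℝ, 0 < K ∧ ∀ᶠ N in atTop, a N ≤ ENNReal.ofReal K := by
  refine ⟨(supGeOne a).toReal + 1, by positivity, ?_⟩
  filter_upwards [eventually_ge_atTop 1] with N hN
  refine (le_iSup₂ (f := fun N (_ : 1 ≤ N) => a N) N hN).trans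
    ((ENNReal.le_ofReal_iff_toReal_le h.ne (by positivity)).2 ?_)
  exact le_add_of_nonneg_right zero_le_one

/-- Every `K > 0` eventually bounds the scaled error, so the limsup of the tail is at most `c * K ^
β` with `c` fixed; let `K → 0`. -/
lemma limsup_weightedTail_eq_zero (μ : Measure ℝ) [IsProbabilityMeasure μ] {ρ α : ℝ}
    (hρ : 0 < ρ) (hα1 : α < 1 / ρ)
    (h : limsup (fun N : ℕ => (N : ℝ≥0∞) ^ α * quantError N μ ρ) atTop = 0) :
    limsup (fun x : ℝ => weightedTail μ (ρ / (1 - α * ρ)) x) atTop = 0 := by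
  obtain ⟨c, hc, H⟩ := exists_eventually_weightedTail_le μ hρ hα1
  have hβ : 0 < ρ / (1 - α * ρ) := by
    rw [div_one_sub_mul_eq hρ]; exact inv_pos.2 (by linarith)
  have hlim : Tendsto (fun K : ℝ => ENNReal.ofReal (c * K ^ (ρ / (1 - α * ρ))))
      (nhdsWithin 0 (Set.Ioi 0)) (nhds 0) := by
    have h1 : Tendsto (fun K : ℝ => ENNReal.ofReal (c * K ^ (ρ / (1 - α * ρ)))) (nhds 0)
        (nhds (ENNReal.ofReal (c * 0 ^ (ρ / (1 - α * ρ))))) :=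
      ENNReal.tendsto_ofReal ((Real.continuousAt_rpow_const 0 _ (Or.inr hβ.le)).tendsto.const_mul c)
    rw [Real.zero_rpow hβ.ne', mul_zero, ENNReal.ofReal_zero] at h1
    exact h1.mono_left nhdsWithin_le_nhds
  refine le_antisymm (ge_of_tendsto hlim ?_) zero_le
  filter_upwards [self_mem_nhdsWithin] with K (hK : 0 < K)
  refine limsup_le_of_le (by isBoundedDefault) (H K hK ?_)
  have : limsup (fun N : ℕ => (N : ℝ≥0∞) ^ α * quantError N μ ρ) atTop < ENNReal.ofReal K := by
    rw [h]; exact ENNReal.ofReal_pos.2 hK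
  exact (eventually_lt_of_limsup_lt this).mono fun _ h => h.le

/-! ### The quantile function and the monotone coupling -/

/-- Right continuity of the distribution function makes the infimum attained. The bounds `u < 1` and
`0 < u` make the defining set nonempty and bounded below, without which `sInf` takes its default
value. -/
lemma quantile_le_iff (μ : Measure ℝ) {u : ℝ} (h0 : 0 < u) (h1 : u < 1) {x : ℝ} :
    quantile μ u ≤ x ↔ u ≤ cdf μ x := by
  constructor
  · intro h
    have hne : {x : ℝ | u ≤ cdf μ x}.Nonempty :=
      (((tendsto_cdf_atTop μ).eventually_const_lt h1).mono fun _ h => h.le).exists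
    have hy : ∀ y ∈ Set.Ioi x, u ≤ cdf μ y := fun y hy => by
      obtain ⟨z, hz, hzy⟩ := exists_lt_of_csInf_lt hne (lt_of_le_of_lt h hy)
      exact le_trans hz (monotone_cdf μ hzy.le)
    have hc : Tendsto (cdf μ) (nhdsWithin x (Set.Ioi x)) (nhds (cdf μ x)) :=
      ((cdf μ).right_continuous x).mono_left (nhdsWithin_mono _ Set.Ioi_subset_Ici_self)
    exact ge_of_tendsto hc (eventually_of_mem self_mem_nhdsWithin hy)
  · intro h
    obtain ⟨y, hy⟩ := ((tendsto_cdf_atBot μ).eventually_lt_const h0).exists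
    refine csInf_le ⟨y, fun z hz => ?_⟩ h
    by_contra! hzy
    exact absurd (le_trans hz (monotone_cdf μ hzy.le)) (not_le.2 hy)

lemma monotoneOn_quantile (μ : Measure ℝ) : MonotoneOn (quantile μ) (Set.Ioo 0 1) :=
  fun _ hu _ hv huv => (quantile_le_iff μ hu.1 hu.2).2
    (huv.trans ((quantile_le_iff μ hv.1 hv.2).1 le_rfl))

lemma aemeasurable_quantile (μ : Measure ℝ) :
    AEMeasurable (quantile μ) (volume.restrict (Set.Ioc 0 1)) := by
  rw [← Measure.restrict_congr_set (Ioo_ae_eq_Ioc (μ := volume) (a := (0 : ℝ)) (b := 1))]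
  exact aemeasurable_restrict_of_monotoneOn measurableSet_Ioo (monotoneOn_quantile μ)

/-- The quantile function transports Lebesgue measure on the unit interval to `μ`. -/
lemma map_quantile (μ : Measure ℝ) [IsProbabilityMeasure μ] :
    (volume.restrict (Set.Ioc 0 1)).map (quantile μ) = μ := by
  have hfin : IsFiniteMeasure ((volume.restrict (Set.Ioc (0 : ℝ) 1)).map (quantile μ)) :=
    inferInstance
  refine Measure.ext_of_Iic _ _ fun x => ?_
  rw [Measure.map_apply_of_aemeasurable (aemeasurable_quantile μ) measurableSet_Iic, ← ofReal_cdf,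
    ← Measure.restrict_congr_set (Ioo_ae_eq_Ioc (μ := volume) (a := (0 : ℝ)) (b := 1)),
    Measure.restrict_apply' measurableSet_Ioo]
  have hle := cdf_le_one μ x
  have h1 : quantile μ ⁻¹' Set.Iic x ∩ Set.Ioo 0 1 = Set.Ioc 0 (cdf μ x) ∩ Set.Ioo 0 1 := by
    ext u
    simp only [Set.mem_inter_iff, Set.mem_preimage, Set.mem_Iic, Set.mem_Ioc, Set.mem_Ioo]
    constructor
    · rintro ⟨h, h0, h1⟩
      exact ⟨⟨h0, (quantile_le_iff μ h0 h1).1 h⟩, h0, h1⟩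
    · rintro ⟨⟨_, h⟩, h0, h1⟩
      exact ⟨(quantile_le_iff μ h0 h1).2 h, h0, h1⟩
  rw [h1, ← Measure.restrict_apply' measurableSet_Ioo,
    Measure.restrict_congr_set (Ioo_ae_eq_Ioc (μ := volume) (a := (0 : ℝ)) (b := 1)),
    Measure.restrict_apply' measurableSet_Ioc, Set.Ioc_inter_Ioc]
  simp [hle]

lemma sum_restrict_Ioc_div (N n : ℕ) :
    ∑ i ∈ Finset.range n, (volume.restrict (Set.Ioc ((i : ℝ) / N) ((i + 1) / N)) : Measure ℝ) =
      volume.restrict (Set.Ioc 0 ((n : ℝ) / N)) := by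
  induction n with
  | zero => simp
  | succ n ih =>
    rw [Finset.sum_range_succ, ih, ← Measure.restrict_union _ measurableSet_Ioc,
      Set.Ioc_union_Ioc_eq_Ioc (by positivity) (by gcongr; linarith)]
    · push_cast; rfl
    · exact Set.Ioc_disjoint_Ioc_of_le le_rfl

lemma quantError_rpow_le_transportCost {N : ℕ} {x : Fin N → ℝ} (hx : Monotone x) {μ : Measure ℝ}
    {π : Measure (ℝ × ℝ)} (hπ : IsCoupling π (uniformAtoms x) μ) {ρ : ℝ} (hρ : 0 < ρ) :
    quantError N μ ρ ^ ρ ≤ ∫⁻ p, ENNReal.ofReal (|p.1 - p.2| ^ ρ) ∂π := by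
  have h : quantError N μ ρ ≤ (∫⁻ p, ENNReal.ofReal (|p.1 - p.2| ^ ρ) ∂π) ^ (1 / ρ) :=
    (iInf₂_le x hx).trans (ENNReal.rpow_le_rpow (iInf₂_le π hπ) (by positivity))
  calc _ ≤ _ := ENNReal.rpow_le_rpow h hρ.le
    _ = _ := by rw [← ENNReal.rpow_mul, one_div_mul_cancel hρ.ne', ENNReal.rpow_one]

/-- A bound on the quantization error from a bound on the cost of the monotone coupling that
splits into a constant on each block and a function of the quantile. -/
lemma quantError_rpow_le {N : ℕ} (hN : 1 ≤ N) {x : ℕ → ℝ}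
    (hx : Monotone fun i : Fin N => x i) (μ : Measure ℝ) [IsProbabilityMeasure μ] {ρ : ℝ}
    (hρ : 0 < ρ) {a : ℕ → ℝ} (ha : ∀ i, 0 ≤ a i) {f : ℝ → ℝ} (hf : Measurable f)
    (hxa : ∀ i < N, ∀ u ∈ Set.Ioo (0 : ℝ) 1, (i : ℝ) / N < u → u ≤ (i + 1) / N →
      |x i - quantile μ u| ^ ρ ≤ a i + max (f (quantile μ u)) 0) :
    quantError N μ ρ ^ ρ ≤ ENNReal.ofReal ((∑ i ∈ Finset.range N, a i) / N) +
      ∫⁻ y, ENNReal.ofReal (f y) ∂μ := by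
  have hN0 : (0 : ℝ) < N := by exact_mod_cast hN
  set v : ℕ → Measure ℝ := fun i => volume.restrict (Set.Ioc ((i : ℝ) / N) ((i + 1) / N)) with hv
  have hsum : ∑ i ∈ Finset.range N, v i = volume.restrict (Set.Ioc 0 1) := by
    rw [hv, sum_restrict_Ioc_div, div_self hN0.ne']
  have hvol : ∀ i, v i Set.univ = ENNReal.ofReal (1 / N) := fun i => by
    simp only [hv, Measure.restrict_apply_univ, Real.volume_Ioc]
    congr 1; ring
  have hvle : ∀ i ∈ Finset.range N, v i ≤ volume.restrict (Set.Ioc 0 1) := fun i hi => by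
    rw [← hsum]; exact Finset.single_le_sum (f := v) (fun _ _ => Measure.zero_le _) hi
  have hQ : ∀ i ∈ Finset.range N, AEMeasurable (quantile μ) (v i) := fun i hi =>
    (aemeasurable_quantile μ).mono_measure (hvle i hi)
  have hP : ∀ i ∈ Finset.range N, AEMeasurable (fun u => (x i, quantile μ u)) (v i) := fun i hi =>
    aemeasurable_const.prodMk (hQ i hi)
  set π : Measure (ℝ × ℝ) := ∑ i ∈ Finset.range N, (v i).map fun u => (x i, quantile μ u) with hπ
  have hcost : ∀ g : ℝ × ℝ → ℝ≥0∞, Measurable g → ∫⁻ p, g p ∂π =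
      ∑ i ∈ Finset.range N, ∫⁻ u, g (x i, quantile μ u) ∂(v i) := fun g hg => by
    rw [hπ, lintegral_finsetSum_measure]
    exact Finset.sum_congr rfl fun i hi => lintegral_map' hg.aemeasurable (hP i hi)
  have hQsum : ∀ g : ℝ → ℝ≥0∞, Measurable g →
      ∑ i ∈ Finset.range N, ∫⁻ u, g (quantile μ u) ∂(v i) = ∫⁻ y, g y ∂μ := fun g hg => by
    rw [← lintegral_finsetSum_measure, hsum]
    conv_rhs => rw [← map_quantile μ]
    exact (lintegral_map' hg.aemeasurable (aemeasurable_quantile μ)).symm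
  have hcpl : IsCoupling π (uniformAtoms fun i : Fin N => x i) μ := by
    constructor
    · ext s hs
      rw [← lintegral_indicator_one hs, lintegral_map (measurable_one.indicator hs) measurable_fst,
        hcost (fun p => s.indicator 1 p.1)
          ((measurable_one.indicator hs).comp measurable_fst)]
      simp only [lintegral_const, hvol, uniformAtoms, Measure.smul_apply, Measure.coe_finsetSum,
        Finset.sum_apply, Measure.dirac_apply' _ hs, smul_eq_mul]
      rw [← Finset.sum_mul, mul_comm, Finset.sum_range, one_div, ENNReal.ofReal_inv_of_pos hN0,
        ENNReal.ofReal_natCast]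
    · ext s hs
      rw [← lintegral_indicator_one hs, lintegral_map (measurable_one.indicator hs) measurable_snd,
        hcost (fun p => s.indicator 1 p.2)
          ((measurable_one.indicator hs).comp measurable_snd),
        hQsum _ (measurable_one.indicator hs), lintegral_indicator_one hs]
  refine (quantError_rpow_le_transportCost hx hcpl hρ).trans ?_
  rw [hcost _ (by fun_prop), ← hQsum _ hf.ennreal_ofReal, Finset.sum_div,
    ENNReal.ofReal_sum_of_nonneg fun i _ => div_nonneg (ha i) hN0.le, ← Finset.sum_add_distrib]
  refine Finset.sum_le_sum fun i hi => ?_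
  have hi' := Finset.mem_range.1 hi
  have hconst : ENNReal.ofReal (a i / N) = ∫⁻ _, ENNReal.ofReal (a i) ∂(v i) := by
    rw [lintegral_const, hvol, ← ENNReal.ofReal_mul (ha i)]
    congr 1; ring
  rw [hconst, ← lintegral_add_left measurable_const]
  refine lintegral_mono_ae ?_
  -- The half-open blocks tile `(0, 1]`; the endpoint 1, where the quantile may be a default value,
  -- is null.
  have hne : ∀ᵐ u : ℝ, u ≠ 1 := by simp [ae_iff]
  filter_upwards [ae_restrict_of_ae hne, ae_restrict_mem measurableSet_Ioc] with u hu1 hu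
  have hu0 : 0 < u := lt_of_le_of_lt (by positivity) hu.1
  have hu2 : u ≤ 1 := hu.2.trans (by
    rw [div_le_one hN0]; exact_mod_cast hi')
  have := hxa i hi' u ⟨hu0, lt_of_le_of_ne hu2 hu1⟩ hu.1 hu.2
  refine (ENNReal.ofReal_le_ofReal this).trans ?_
  rw [ENNReal.ofReal_add (ha i) (le_max_right _ _)]
  simp

/-! ### Layer-cake estimate of the truncated moment -/

lemma lintegral_Ioi_add_rpow_neg {s m : ℝ} (hs : 1 < s) (hm : 0 < m) :
    ∫⁻ t in Set.Ioi (0 : ℝ), ENNReal.ofReal ((t + m) ^ (-s)) =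
      ENNReal.ofReal (m ^ (1 - s) / (s - 1)) := by
  have hint : IntegrableOn (fun t : ℝ => (t + m) ^ (-s)) (Set.Ioi 0) :=
    integrableOn_add_rpow_Ioi_of_lt (by linarith) (by linarith)
  rw [← ofReal_integral_eq_lintegral_ofReal hint]
  · congr 1
    have hd : ∀ x ∈ Set.Ici (0 : ℝ), HasDerivAt (fun t => (t + m) ^ (1 - s) / (1 - s))
        ((x + m) ^ (-s)) x := by
      intro x hx
      have hx : 0 ≤ x := hx
      have h := (((hasDerivAt_id x).add_const m).rpow_const (p := 1 - s)
        (Or.inl (by simp only [id_eq]; linarith))).div_const (1 - s)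
      rw [show 1 - s - 1 = -s by ring, one_mul] at h
      refine h.congr_deriv ?_
      have : 1 - s ≠ 0 := by linarith
      simp only [id_eq]
      field_simp
    have ht : Tendsto (fun t : ℝ => (t + m) ^ (1 - s) / (1 - s)) atTop (nhds (0 / (1 - s))) := by
      refine Tendsto.div_const ?_ _
      have := (tendsto_rpow_neg_atTop (by linarith : 0 < s - 1)).comp
        (tendsto_atTop_add_const_right atTop m tendsto_id)
      rw [neg_sub] at this
      exact this
    rw [integral_Ioi_of_hasDerivAt_of_tendsto' hd hint ht, zero_add, zero_div, zero_sub, ← div_neg,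
      neg_sub]
  · filter_upwards [ae_restrict_mem measurableSet_Ioi] with t ht
    have : (0 : ℝ) < t := ht
    positivity

/-- Layer-cake bound for the part of the `ρ`-th moment above the level `m`. -/
lemma lintegral_abs_rpow_sub_le (μ : Measure ℝ) [IsProbabilityMeasure μ] {ρ β c m : ℝ}
    (hρ : 0 < ρ) (hβ : ρ < β) (hc : 0 ≤ c) (hm : 0 < m)
    (h : ∀ x, 0 ≤ x → x ^ β * μ.real {y | x < |y|} ≤ c) :
    ∫⁻ y, ENNReal.ofReal (|y| ^ ρ - m) ∂μ ≤
      ENNReal.ofReal (c * (m ^ (1 - β / ρ) / (β / ρ - 1))) := by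
  have e : ∀ y : ℝ, ENNReal.ofReal (|y| ^ ρ - m) = ENNReal.ofReal (max (|y| ^ ρ - m) 0) := by simp
  simp_rw [e]
  rw [lintegral_eq_lintegral_meas_lt μ (f := fun y => max (|y| ^ ρ - m) 0)
    (Eventually.of_forall fun y => le_max_right _ _) (by fun_prop), ENNReal.ofReal_mul hc,
    ← lintegral_Ioi_add_rpow_neg ((one_lt_div hρ).2 hβ) hm, ← lintegral_const_mul _ (by fun_prop)]
  refine setLIntegral_mono (by fun_prop) fun t ht => ?_
  have ht : 0 < t := ht
  have htm : 0 < t + m := by linarith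
  -- The event `t < |y| ^ ρ - m` is `(t + m) ^ (1 / ρ) < |y|`, so the tail hypothesis gives the
  -- integrand `c * (t + m) ^ (-(β / ρ))`.
  have hx := h ((t + m) ^ (1 / ρ)) (by positivity)
  rw [← Real.rpow_mul htm.le, one_div_mul_eq_div] at hx
  rw [← ENNReal.ofReal_mul hc]
  refine (ENNReal.le_ofReal_iff_toReal_le (measure_ne_top _ _) (by positivity)).2 ?_
  rw [Real.rpow_neg htm.le, ← div_eq_mul_inv, le_div_iff₀ (by positivity), mul_comm]
  refine le_trans (mul_le_mul_of_nonneg_left (measureReal_mono fun y hy => ?_) (by positivity)) hx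
  have hy : t < max (|y| ^ ρ - m) 0 := hy
  have hy' : t + m < |y| ^ ρ := by
    rcases lt_max_iff.1 hy with h | h <;> linarith
  change (t + m) ^ (1 / ρ) < |y|
  rwa [one_div, Real.rpow_inv_lt_iff_of_pos htm.le (abs_nonneg y) hρ]

/-! ### Elementary inequalities for the block costs -/

/-- Superadditivity of `t ^ ρ` on `t ≥ 0` for `ρ ≥ 1`, applied to telescoping increments. -/
lemma sum_rpow_sub_le {q : ℕ → ℝ} {n : ℕ} (hq : ∀ i < n, q i ≤ q (i + 1)) {ρ : ℝ} (hρ : 1 ≤ ρ) :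
    q 0 ≤ q n ∧ ∑ i ∈ Finset.range n, (q (i + 1) - q i) ^ ρ ≤ (q n - q 0) ^ ρ := by
  induction n with
  | zero => simp [Real.zero_rpow (by linarith : ρ ≠ 0)]
  | succ n ih =>
    obtain ⟨h1, h2⟩ := ih fun i hi => hq i (hi.trans (Nat.lt_succ_self n))
    have h3 := hq n (Nat.lt_succ_self n)
    refine ⟨h1.trans h3, ?_⟩
    rw [Finset.sum_range_succ]
    refine (add_le_add_left h2 _).trans ((Real.add_rpow_le_rpow_add (by linarith) (by linarith)
      hρ).trans (le_of_eq ?_))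
    congr 1; ring

/-- Cost of the leftmost atom. A point to its right lies within `max (q + M) 0`; a point to its left
is below `-M`, at distance at most `|Q| - M`, and superadditivity gives `(|Q| - M) ^ ρ ≤ |Q| ^ ρ - M
^ ρ`. -/
lemma abs_min_neg_sub_rpow_le {q Q M ρ : ℝ} (hQ : Q ≤ q) (hM : 0 ≤ M) (hρ : 1 ≤ ρ) :
    |min q (-M) - Q| ^ ρ ≤ max (q + M) 0 ^ ρ + max (|Q| ^ ρ - M ^ ρ) 0 := by
  have hρ0 : 0 ≤ ρ := by linarith
  rcases le_total (min q (-M)) Q with h | h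
  · refine le_add_of_le_of_nonneg (Real.rpow_le_rpow (abs_nonneg _) ?_ hρ0) (le_max_right _ _)
    rw [abs_sub_comm, abs_of_nonneg (by linarith)]
    rcases min_choice q (-M) with e | e <;> rw [e]
    · exact le_max_of_le_right (by linarith)
    · exact le_max_of_le_left (by linarith)
  · have h' : Q ≤ -M := h.trans (min_le_right _ _)
    refine le_add_of_nonneg_of_le (by positivity) (le_max_of_le_left ?_)
    rw [abs_of_nonneg (by linarith), abs_of_nonpos (by linarith : Q ≤ 0)]
    have h1 : (min q (-M) - Q) ^ ρ ≤ (-Q - M) ^ ρ :=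
      Real.rpow_le_rpow (by linarith) (by linarith [min_le_right q (-M)]) hρ0
    have h2 := Real.add_rpow_le_rpow_add (by linarith : 0 ≤ -Q - M) hM hρ
    rw [sub_add_cancel] at h2
    linarith

lemma abs_max_sub_rpow_le {q Q M ρ : ℝ} (hQ : q ≤ Q) (hM : 0 ≤ M) (hρ : 1 ≤ ρ) :
    |max q M - Q| ^ ρ ≤ max (M - q) 0 ^ ρ + max (|Q| ^ ρ - M ^ ρ) 0 := by
  have h := abs_min_neg_sub_rpow_le (neg_le_neg hQ) hM hρ
  rwa [min_neg_neg, neg_sub_neg, abs_sub_comm, abs_neg, neg_add_eq_sub] at h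

/-- The sign of the median `m` decides which end is bounded by `M ^ ρ` alone, so the convexity
factor `2 ^ (ρ - 1)` is paid only once. -/
lemma max_add_rpow_add_max_sub_rpow_le {a b m M ρ : ℝ} (ha : a ≤ m) (hb : m ≤ b) (hM : 0 ≤ M)
    (hρ : 1 ≤ ρ) : max (a + M) 0 ^ ρ + max (M - b) 0 ^ ρ ≤
      M ^ ρ + 2 ^ (ρ - 1) * (M ^ ρ + |m| ^ ρ) := by
  have hρ0 : 0 ≤ ρ := by linarith
  have h2 : (M + |m|) ^ ρ ≤ 2 ^ (ρ - 1) * (M ^ ρ + |m| ^ ρ) := by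
    lift M to NNReal using hM
    have := NNReal.rpow_add_le_mul_rpow_add_rpow M (Real.nnabs m) hρ
    exact_mod_cast this
  have key : ∀ y, y ≤ M → max y 0 ^ ρ ≤ M ^ ρ := fun y hy =>
    Real.rpow_le_rpow (le_max_right _ _) (max_le hy hM) hρ0
  have key' : ∀ y, y ≤ M + |m| → max y 0 ^ ρ ≤ (M + |m|) ^ ρ := fun y hy =>
    Real.rpow_le_rpow (le_max_right _ _) (max_le hy (by positivity)) hρ0
  rcases le_total 0 m with h | h
  · have h3 := key (M - b) (by linarith)
    have h4 := key' (a + M) (by linarith [le_abs_self m])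
    linarith
  · have h3 := key (a + M) (by linarith)
    have h4 := key' (M - b) (by linarith [neg_abs_le m])
    linarith

/-- Beyond `(c / v) ^ β⁻¹` the two tails together have mass less than `v`, hence so does each of
them. -/
lemma quantile_bounds_of_tail_le {μ : Measure ℝ} {β c : ℝ} (hβ : 0 < β)
    (hc : 0 ≤ c) (h : ∀ x, 0 ≤ x → x ^ β * (cdf μ (-x) + 1 - cdf μ x) ≤ c) {v : ℝ}
    (hv0 : 0 < v) (hv1 : v < 1) :
    -(c / v) ^ β⁻¹ ≤ quantile μ v ∧ quantile μ (1 - v) ≤ (c / v) ^ β⁻¹ := by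
  have key : ∀ x, (c / v) ^ β⁻¹ < x → cdf μ (-x) + 1 - cdf μ x < v := fun x hx => by
    have hx0 : 0 < x := lt_of_le_of_lt (by positivity) hx
    rw [Real.rpow_inv_lt_iff_of_pos (by positivity) hx0.le hβ, div_lt_iff₀ hv0] at hx
    have h1 := h x hx0.le
    have h2 : 0 < x ^ β := by positivity
    by_contra! h3
    nlinarith
  constructor
  · refine neg_le.1 (le_of_forall_gt_imp_ge_of_dense fun x hx => ?_)
    have h1 := key x hx
    refine neg_le.1 (le_of_not_ge fun h2 => ?_)
    have h3 := (quantile_le_iff μ hv0 hv1).1 h2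
    linarith [cdf_le_one μ x]
  · refine le_of_forall_gt_imp_ge_of_dense fun x hx => ?_
    have h1 := key x hx
    rw [quantile_le_iff μ (by linarith) (by linarith)]
    linarith [cdf_nonneg μ (-x)]

/-! ### Upper bounds for the quantization error -/

lemma quantError_one_rpow_le (μ : Measure ℝ) [IsProbabilityMeasure μ] {ρ : ℝ} (hρ : 0 < ρ) :
    quantError 1 μ ρ ^ ρ ≤ 1 + ∫⁻ y, ENNReal.ofReal (|y| ^ ρ - 1) ∂μ := by
  have h := quantError_rpow_le le_rfl (x := fun _ => 0) (monotone_const) μ hρ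
    (a := fun _ => 1) (fun _ => zero_le_one) (f := fun y => |y| ^ ρ - 1) (by fun_prop) ?_
  · simpa using h
  · intro i _ u _ _ _
    rw [zero_sub, abs_neg]
    linarith [le_max_left (|quantile μ u| ^ ρ - 1) 0]

/-- Interior atoms at quantiles, extreme atoms pushed outside `[-M, M]`. -/
lemma quantError_add_two_rpow_le (n : ℕ) (μ : Measure ℝ) [IsProbabilityMeasure μ] {ρ M : ℝ}
    (hρ : 1 ≤ ρ) (hM : 0 ≤ M) {q : ℕ → ℝ} (hq : ∀ i, q i = quantile μ (i / ((n + 2 : ℕ) : ℝ))) :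
    quantError (n + 2) μ ρ ^ ρ ≤
      ENNReal.ofReal ((max (q 1 + M) 0 ^ ρ + max (M - q (n + 1)) 0 ^ ρ + (q (n + 1) - q 1) ^ ρ) /
        (n + 2 : ℕ)) + ∫⁻ y, ENNReal.ofReal (|y| ^ ρ - M ^ ρ) ∂μ := by
  set N : ℕ := n + 2 with hN
  have hN0 : (0 : ℝ) < N := by rw [hN]; positivity
  have hρ0 : 0 < ρ := by linarith
  have hmem : ∀ i : ℕ, 1 ≤ i → i ≤ n + 1 → (i : ℝ) / N ∈ Set.Ioo (0 : ℝ) 1 := fun i h1 h2 => by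
    have h1' : (0 : ℝ) < i := by exact_mod_cast h1
    refine ⟨by positivity, ?_⟩
    rw [div_lt_one hN0]
    exact_mod_cast (by omega : i < N)
  have hqm : ∀ i j : ℕ, 1 ≤ i → i ≤ j → j ≤ n + 1 → q i ≤ q j := fun i j h1 h2 h3 => by
    rw [hq, hq]
    refine monotoneOn_quantile μ (hmem i h1 (h2.trans h3)) (hmem j (h1.trans h2) h3) ?_
    gcongr
  set x : ℕ → ℝ := fun i => if i = 0 then min (q 1) (-M) else
    if i = n + 1 then max (q (n + 1)) M else q (i + 1) with hx
  set a : ℕ → ℝ := fun i => if i = 0 then max (q 1 + M) 0 ^ ρ else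
    if i = n + 1 then max (M - q (n + 1)) 0 ^ ρ else |q (i + 1) - q i| ^ ρ with ha
  have hxmono : Monotone fun i : Fin N => x i := by
    intro i j hij
    have hij' : (i : ℕ) ≤ j := hij
    have hj : (j : ℕ) < n + 2 := j.2
    simp only [hx]
    split_ifs with h1 h2 h3 h4 h5 h6 h7 h8
    · exact le_rfl
    · exact (min_le_right _ _).trans ((by linarith : -M ≤ M).trans (le_max_right _ _))
    · exact (min_le_left _ _).trans (hqm _ _ le_rfl (by omega) (by omega))
    · omega
    · exact le_rfl
    · omega
    · omega
    · exact (hqm _ _ (by omega) (by omega) le_rfl).trans (le_max_left _ _)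
    · exact hqm _ _ (by omega) (by omega) (by omega)
  have ha0 : ∀ i, 0 ≤ a i := fun i => by
    simp only [ha]
    split_ifs <;> positivity
  have hsum : ∑ i ∈ Finset.range N, a i ≤
      max (q 1 + M) 0 ^ ρ + max (M - q (n + 1)) 0 ^ ρ + (q (n + 1) - q 1) ^ ρ := by
    have h1 := (sum_rpow_sub_le (q := fun i => q (i + 1)) (n := n)
      (fun i hi => hqm _ _ (by omega) (by omega) (by omega)) hρ).2
    have h2 : ∑ i ∈ Finset.range n, a (i + 1) =
        ∑ i ∈ Finset.range n, (q (i + 1 + 1) - q (i + 1)) ^ ρ := by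
      refine Finset.sum_congr rfl fun i hi => ?_
      have hi := Finset.mem_range.1 hi
      have h3 := hqm (i + 1) (i + 1 + 1) (by omega) (by omega) (by omega)
      simp only [ha]
      rw [if_neg (by omega), if_neg (by omega), abs_of_nonneg (by linarith)]
    have h4 : a 0 = max (q 1 + M) 0 ^ ρ := by simp [ha]
    have h5 : a (n + 1) = max (M - q (n + 1)) 0 ^ ρ := by simp [ha]
    rw [hN, Finset.sum_range_succ, Finset.sum_range_succ', h2, h4, h5]
    simp only [zero_add] at h1
    linarith
  refine (quantError_rpow_le (by omega) hxmono μ hρ0 ha0 (f := fun y => |y| ^ ρ - M ^ ρ)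
    (by fun_prop) ?_).trans (by gcongr)
  intro i hi u hu hu1 hu2
  have hlow : 1 ≤ i → q i ≤ quantile μ u := fun h => by
    rw [hq]; exact monotoneOn_quantile μ (hmem i h (by omega)) hu hu1.le
  have hup : i < n + 1 → quantile μ u ≤ q (i + 1) := fun h => by
    rw [hq]
    refine monotoneOn_quantile μ hu (hmem (i + 1) (by omega) (by omega)) (hu2.trans (le_of_eq ?_))
    push_cast; rfl
  simp only [hx, ha]
  split_ifs with h1 h2
  · subst h1
    exact abs_min_neg_sub_rpow_le (hup (by omega)) hM hρ
  · subst h2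
    exact abs_max_sub_rpow_le (hlow (by omega)) hM hρ
  · refine le_add_of_le_of_nonneg (Real.rpow_le_rpow (abs_nonneg _) ?_ hρ0.le) (le_max_right _ _)
    have h3 := hlow (by omega)
    have h4 := hup (by omega)
    rw [abs_of_nonneg (by linarith), abs_of_nonneg (by linarith)]
    linarith

lemma quantError_rpow_le_of_tail_le (μ : Measure ℝ) [IsProbabilityMeasure μ] {ρ α c : ℝ}
    (hρ : 1 ≤ ρ) (hα0 : 0 < α) (hα1 : α < 1 / ρ) (hc : 0 ≤ c)
    (h : ∀ x, 0 ≤ x → x ^ (ρ / (1 - α * ρ)) * (cdf μ (-x) + 1 - cdf μ x) ≤ c)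
    {N : ℕ} (hN : 1 ≤ N) :
    quantError N μ ρ ^ ρ ≤ ENNReal.ofReal ((N : ℝ) ^ (-(α * ρ)) *
      (2 ^ ρ * c ^ (1 - α * ρ) + (1 - α * ρ) / (α * ρ) * c + 1 + 2 ^ (ρ - 1)
        + 2 ^ (ρ + α * ρ - 2) * |quantile μ (1 / 2)| ^ ρ)) := by
  have hρ0 : 0 < ρ := by linarith
  have hαρ : 0 < α * ρ := by positivity
  have hτ : 0 < 1 - α * ρ := by
    rw [lt_div_iff₀ hρ0] at hα1; linarith
  have hβ : ρ < ρ / (1 - α * ρ) := by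
    rw [lt_div_iff₀ hτ]; nlinarith
  have hβ0 : 0 < ρ / (1 - α * ρ) := by positivity
  have hN0 : (0 : ℝ) < N := by exact_mod_cast hN
  have htail := lintegral_abs_rpow_sub_le μ (m := (N : ℝ) ^ (1 - α * ρ)) hρ0 hβ hc (by positivity)
    fun x hx => (mul_le_mul_of_nonneg_left (radial_le_cdf_tail μ x) (by positivity)).trans (h x hx)
  have e1 : ((N : ℝ) ^ (1 - α * ρ)) ^ (1 - ρ / (1 - α * ρ) / ρ) = (N : ℝ) ^ (-(α * ρ)) := by
    rw [← Real.rpow_mul hN0.le]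
    congr 1
    field_simp
    ring
  have e2 : ρ / (1 - α * ρ) / ρ - 1 = α * ρ / (1 - α * ρ) := by
    rw [div_right_comm, div_self hρ0.ne', div_sub_one hτ.ne', sub_sub_cancel]
  rw [e1, e2] at htail
  have e3 : c * ((N : ℝ) ^ (-(α * ρ)) / (α * ρ / (1 - α * ρ))) =
      (N : ℝ) ^ (-(α * ρ)) * ((1 - α * ρ) / (α * ρ) * c) := by
    field_simp
  rw [e3] at htail
  -- A single atom cannot serve both ends; for `N = 1` it is placed at 0 and the median is not
  -- needed.
  obtain rfl | ⟨n, rfl⟩ : N = 1 ∨ ∃ n, N = n + 2 := by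
    rcases Nat.lt_or_ge N 2 with h | h
    · left; omega
    · exact Or.inr ⟨N - 2, by omega⟩
  · simp only [Nat.cast_one, Real.one_rpow, one_mul] at htail ⊢
    refine (quantError_one_rpow_le μ hρ0).trans ((add_le_add_right htail 1).trans ?_)
    rw [← ENNReal.ofReal_one, ← ENNReal.ofReal_add zero_le_one (by positivity)]
    refine ENNReal.ofReal_le_ofReal ?_
    have p1 : 0 ≤ 2 ^ ρ * c ^ (1 - α * ρ) := by positivity
    have p2 : (0 : ℝ) ≤ 2 ^ (ρ - 1) := by positivity
    have p3 : 0 ≤ 2 ^ (ρ + α * ρ - 2) * |quantile μ (1 / 2)| ^ ρ := by positivity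
    linarith
  · set N : ℕ := n + 2 with hNn
    have hN2 : (2 : ℝ) ≤ N := by exact_mod_cast (by omega : 2 ≤ N)
    set q : ℕ → ℝ := fun i => quantile μ (i / (N : ℝ)) with hq
    set M : ℝ := (N : ℝ) ^ ((1 - α * ρ) / ρ) with hM
    have hMρ : M ^ ρ = (N : ℝ) ^ (1 - α * ρ) := by
      rw [hM, ← Real.rpow_mul hN0.le, div_mul_cancel₀ _ hρ0.ne']
    have main := quantError_add_two_rpow_le n μ hρ (by positivity : 0 ≤ M) (q := q) fun _ => rfl
    rw [hMρ] at main
    have hv0 : 0 < 1 / (N : ℝ) := by positivity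
    have hv2 : 1 / (N : ℝ) ≤ 1 / 2 := by gcongr
    obtain ⟨b1, b2⟩ := quantile_bounds_of_tail_le hβ0 hc h hv0 (by linarith)
    have q1 : q 1 = quantile μ (1 / N) := by simp [hq]
    have q2 : q (n + 1) = quantile μ (1 - 1 / N) := by
      simp only [hq]
      congr 1
      have : ((n + 1 : ℕ) : ℝ) = N - 1 := by rw [hNn]; push_cast; ring
      rw [this]; field_simp
    rw [← q1] at b1
    rw [← q2] at b2
    have m1 : q 1 ≤ quantile μ (1 / 2) := by
      rw [q1]; exact monotoneOn_quantile μ ⟨hv0, by linarith⟩ ⟨by norm_num, by norm_num⟩ hv2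
    have m2 : quantile μ (1 / 2) ≤ q (n + 1) := by
      rw [q2]
      exact monotoneOn_quantile μ ⟨by norm_num, by norm_num⟩ ⟨by linarith, by linarith⟩
        (by linarith)
    have hmid : (q (n + 1) - q 1) ^ ρ ≤ (N : ℝ) ^ (1 - α * ρ) * (2 ^ ρ * c ^ (1 - α * ρ)) := by
      calc _ ≤ (2 * (c / (1 / N)) ^ (ρ / (1 - α * ρ))⁻¹) ^ ρ :=
            Real.rpow_le_rpow (by linarith) (by linarith) hρ0.le
        _ = _ := by
          rw [Real.mul_rpow (by norm_num) (by positivity), ← Real.rpow_mul (by positivity), inv_div,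
            div_mul_cancel₀ _ hρ0.ne', div_div_eq_mul_div, div_one, Real.mul_rpow hc hN0.le]
          ring
    have hends := max_add_rpow_add_max_sub_rpow_le m1 m2 (by positivity : 0 ≤ M) hρ
    rw [hMρ] at hends
    refine main.trans ((add_le_add_right htail _).trans ?_)
    rw [← ENNReal.ofReal_add (by have : 0 ≤ q (n + 1) - q 1 := by linarith
                                 positivity) (by positivity)]
    refine ENNReal.ofReal_le_ofReal ?_
    have eN : (N : ℝ) ^ (1 - α * ρ) = (N : ℝ) ^ (-(α * ρ)) * N := by
      rw [sub_eq_neg_add, Real.rpow_add hN0, Real.rpow_one]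
    -- Only the median term carries a bare `1 / N`. Since `N ≥ 2`, `N ^ (α * ρ - 1) ≤ 2 ^ (α * ρ -
    -- 1)`, whence the exponent `ρ + α * ρ - 2`.
    have hquot : (1 : ℝ) / N ≤ (N : ℝ) ^ (-(α * ρ)) * 2 ^ (α * ρ - 1) := by
      rw [div_le_iff₀ hN0, mul_assoc, mul_comm (2 ^ _) (N : ℝ), ← mul_assoc, ← eN,
        ← neg_sub 1 (α * ρ), Real.rpow_neg (by norm_num), ← div_eq_mul_inv,
        one_le_div (by positivity)]
      exact Real.rpow_le_rpow (by norm_num) hN2 hτ.le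
    have e4 : (2 : ℝ) ^ (ρ + α * ρ - 2) = 2 ^ (ρ - 1) * 2 ^ (α * ρ - 1) := by
      rw [← Real.rpow_add (by norm_num)]; congr 1; ring
    set m : ℝ := |quantile μ (1 / 2)| ^ ρ with hm
    have hm0 : 0 ≤ m := by positivity
    set T : ℝ := (N : ℝ) ^ (-(α * ρ)) with hT
    calc _ ≤ (T * N + 2 ^ (ρ - 1) * (T * N + m) + T * N * (2 ^ ρ * c ^ (1 - α * ρ))) / N
          + T * ((1 - α * ρ) / (α * ρ) * c) := by
          rw [← eN]; gcongr
      _ = T * (2 ^ ρ * c ^ (1 - α * ρ) + (1 - α * ρ) / (α * ρ) * c + 1 + 2 ^ (ρ - 1))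
          + 2 ^ (ρ - 1) * m * (1 / N) := by
          field_simp
          ring
      _ ≤ T * (2 ^ ρ * c ^ (1 - α * ρ) + (1 - α * ρ) / (α * ρ) * c + 1 + 2 ^ (ρ - 1))
          + 2 ^ (ρ - 1) * m * (T * 2 ^ (α * ρ - 1)) := by gcongr
      _ = _ := by rw [e4]; ring

/-! ### Passage to suprema and conclusion -/

lemma mul_le_toReal_tailSup {μ : Measure ℝ} {β : ℝ} (h : tailSup μ β ≠ ∞) {x : ℝ} (hx : 0 ≤ x) :
    x ^ β * (cdf μ (-x) + 1 - cdf μ x) ≤ (tailSup μ β).toReal := by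
  have h1 : weightedTail μ β x ≤ tailSup μ β :=
    le_iSup₂ (f := fun x (_ : 0 ≤ x) => weightedTail μ β x) x hx
  refine (ENNReal.ofReal_le_ofReal_iff ENNReal.toReal_nonneg).1 ?_
  rwa [ENNReal.ofReal_toReal h]

lemma supGeOne_quantError_rpow_le (μ : Measure ℝ) [IsProbabilityMeasure μ] {ρ α : ℝ}
    (hρ : 1 ≤ ρ) (hα0 : 0 < α) (hα1 : α < 1 / ρ) :
    supGeOne (fun N => (N : ℝ≥0∞) ^ (α * ρ) * quantError N μ ρ ^ ρ) ≤
      2 ^ ρ * tailSup μ (ρ / (1 - α * ρ)) ^ (1 - α * ρ)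
        + ENNReal.ofReal ((1 - α * ρ) / (α * ρ)) * tailSup μ (ρ / (1 - α * ρ))
        + 1 + 2 ^ (ρ - 1)
        + 2 ^ (ρ + α * ρ - 2) * ENNReal.ofReal (|quantile μ (1 / 2)| ^ ρ) := by
  have hρ0 : 0 < ρ := by linarith
  have hαρ : 0 < α * ρ := by positivity
  have hτ : 0 < 1 - α * ρ := by
    rw [lt_div_iff₀ hρ0] at hα1; linarith
  by_cases hC : tailSup μ (ρ / (1 - α * ρ)) = ∞
  · rw [hC, ENNReal.top_rpow_of_pos hτ, ENNReal.mul_top (by simp)]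
    simp
  refine iSup₂_le fun N hN => ?_
  have hN0 : (0 : ℝ) < N := by exact_mod_cast hN
  have h := quantError_rpow_le_of_tail_le μ hρ hα0 hα1 ENNReal.toReal_nonneg
    (fun x hx => mul_le_toReal_tailSup hC hx) hN
  set c := (tailSup μ (ρ / (1 - α * ρ))).toReal with hc
  have hc0 : 0 ≤ c := ENNReal.toReal_nonneg
  rw [← ENNReal.ofReal_toReal hC, ← hc]
  have e2 : ∀ s : ℝ, (2 : ℝ≥0∞) ^ s = ENNReal.ofReal (2 ^ s) := fun s => by
    rw [← ENNReal.ofReal_rpow_of_pos two_pos, ENNReal.ofReal_ofNat]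
  simp only [e2]
  refine (mul_le_mul_right h _).trans (le_of_eq ?_)
  rw [← ENNReal.ofReal_natCast, ENNReal.ofReal_rpow_of_pos hN0,
    ENNReal.ofReal_rpow_of_nonneg hc0 hτ.le, ← ENNReal.ofReal_one,
    ← ENNReal.ofReal_mul (by positivity), ← ENNReal.ofReal_mul (by positivity),
    ← ENNReal.ofReal_mul (by positivity), ← ENNReal.ofReal_mul (by positivity),
    ← ENNReal.ofReal_add (by positivity) (by positivity),
    ← ENNReal.ofReal_add (by positivity) (by positivity),
    ← ENNReal.ofReal_add (by positivity) (by positivity),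
    ← ENNReal.ofReal_add (by positivity) (by positivity), ← mul_assoc, ← Real.rpow_add hN0,
    add_neg_cancel, Real.rpow_zero, one_mul]

lemma supGeOne_quantError_lt_top (μ : Measure ℝ) [IsProbabilityMeasure μ] {ρ α : ℝ}
    (hρ : 1 ≤ ρ) (hα0 : 0 < α) (hα1 : α < 1 / ρ) (h : tailSup μ (ρ / (1 - α * ρ)) < ∞) :
    supGeOne (fun N => (N : ℝ≥0∞) ^ α * quantError N μ ρ) < ∞ := by
  have hρ0 : 0 < ρ := by linarith
  have hτ : 0 < 1 - α * ρ := by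
    rw [lt_div_iff₀ hρ0] at hα1; linarith
  have h1 := supGeOne_quantError_rpow_le μ hρ hα0 hα1
  set B := supGeOne (fun N => (N : ℝ≥0∞) ^ (α * ρ) * quantError N μ ρ ^ ρ) with hB
  have hBtop : B < ∞ := by
    refine h1.trans_lt ?_
    have e2 : ∀ s : ℝ, (2 : ℝ≥0∞) ^ s < ∞ := fun s =>
      (ENNReal.rpow_ne_top_of_ne_zero (by simp) (by simp)).lt_top
    simp only [ENNReal.add_lt_top]
    exact ⟨⟨⟨⟨ENNReal.mul_lt_top (e2 _) (ENNReal.rpow_lt_top_of_nonneg hτ.le h.ne),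
      ENNReal.mul_lt_top ENNReal.ofReal_lt_top h⟩, ENNReal.one_lt_top⟩, e2 _⟩,
      ENNReal.mul_lt_top (e2 _) ENNReal.ofReal_lt_top⟩
  refine lt_of_le_of_lt (iSup₂_le fun N hN => ?_)
    (ENNReal.rpow_lt_top_of_nonneg (inv_nonneg.2 hρ0.le) hBtop.ne : B ^ ρ⁻¹ < ∞)
  rw [ENNReal.le_rpow_inv_iff hρ0, ENNReal.mul_rpow_of_nonneg _ _ hρ0.le, ← ENNReal.rpow_mul]
  exact le_iSup₂ (f := fun (N : ℕ) (_ : 1 ≤ N) =>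
    (N : ℝ≥0∞) ^ (α * ρ) * quantError N μ ρ ^ ρ) N hN

theorem theorem2 (μ : Measure ℝ) [IsProbabilityMeasure μ] (ρ α : ℝ)
    (hρ : 1 ≤ ρ) (hα0 : 0 < α) (hα1 : α < 1 / ρ) :
    (tailSup μ (ρ / (1 - α * ρ)) < ∞ ↔
      supGeOne (fun N => (N : ℝ≥0∞) ^ α * quantError N μ ρ) < ∞) ∧
    supGeOne (fun N => (N : ℝ≥0∞) ^ (α * ρ) * quantError N μ ρ ^ ρ) ≤
      2 ^ ρ * tailSup μ (ρ / (1 - α * ρ)) ^ (1 - α * ρ)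
        + ENNReal.ofReal ((1 - α * ρ) / (α * ρ)) * tailSup μ (ρ / (1 - α * ρ))
        + 1 + 2 ^ (ρ - 1)
        + 2 ^ (ρ + α * ρ - 2) * ENNReal.ofReal (|quantile μ (1 / 2)| ^ ρ) ∧
    ((0 < limsup (fun x : ℝ => weightedTail μ (ρ / (1 - α * ρ)) x) atTop ∧
        limsup (fun x : ℝ => weightedTail μ (ρ / (1 - α * ρ)) x) atTop < ∞) →
      0 < limsup (fun N : ℕ => (N : ℝ≥0∞) ^ α * quantError N μ ρ) atTop ∧
        limsup (fun N : ℕ => (N : ℝ≥0∞) ^ α * quantError N μ ρ) atTop < ∞) := by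
  have hρ0 : 0 < ρ := by linarith
  have hβ : 0 ≤ ρ / (1 - α * ρ) := by
    rw [div_one_sub_mul_eq hρ0]; exact inv_nonneg.2 (by linarith)
  refine ⟨⟨supGeOne_quantError_lt_top μ hρ hα0 hα1, fun h => ?_⟩,
    supGeOne_quantError_rpow_le μ hρ hα0 hα1, fun ⟨h0, htop⟩ => ⟨?_, ?_⟩⟩
  · obtain ⟨c, -, H⟩ := exists_eventually_weightedTail_le μ hρ0 hα1
    obtain ⟨K, hK, hKN⟩ := exists_eventually_le_of_supGeOne_lt_top h
    exact tailSup_lt_top_of_eventually_le μ hβ ENNReal.ofReal_lt_top (H K hK hKN)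
  · refine pos_iff_ne_zero.2 fun h => h0.ne' (limsup_weightedTail_eq_zero μ hρ0 hα1 h)
  -- A finite limsup of the weighted tail makes its supremum finite, so the equivalence applies.
  · obtain ⟨b, hb, hb'⟩ := exists_between htop
    have hT := tailSup_lt_top_of_eventually_le μ hβ hb'
      ((eventually_lt_of_limsup_lt hb).mono fun _ h => h.le)
    obtain ⟨K, -, hKN⟩ := exists_eventually_le_of_supGeOne_lt_top
      (supGeOne_quantError_lt_top μ hρ hα0 hα1 hT)
    exact (limsup_le_of_le (by isBoundedDefault) hKN).trans_lt ENNReal.ofReal_lt_top
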